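/- **Setting.** A structural causal model (SCM) $\mathcal M$ has finitely many endogenous variables $V$, each given by a measurable structural function $V \leftarrow f_V(\mathrm{Pa}^V, \mathcal E^V)$ of its endogenous parents $\mathrm{Pa}^V$ and of some exogenous variables $\mathcal E^V$; the finitely many exogenous variables are independent. Its associated graph, which has all endogenous and exogenous variables as nodes and an edge into $V$ from each member of $\mathrm{Pa}^V\cup\mathcal E^V$, is assumed acyclic; $\mathcal M$ is compatible with this graph. An SL SCM has distinct real-valued endogenous variables $Y$ (outcome), $\hat Y$ (prediction) and $U$ (utility), where $f_U$ is a function of exactly $Y$ and $\hat Y$, and an endogenous sensitive variable $A\neq U$ whose domain contains values $a_0, a_1$; its graph is called an SL graph. The members of $\mathrm{Pa}(\hat Y)=\mathrm{Pa}^{\hat Y}$ (the endogenous parents of $\hat Y$) are the features. A predictor is a (measurable) map $\pi:\mathrm{dom}(\mathrm{Pa}(\hat Y))\to\mathrm{dom}(\hat Y)$; $\mathcal M_\pi$ is $\mathcal M$ with $f_{\hat Y}$ replaced by $\pi$; $\pi$ is optimal if it maximizes $\mathbb E(U)$ in $\mathcal M_\pi$ over all predictors, with a finite maximum. The function $f_U$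 is P-admissible if the predictor $\pi(\mathrm{Pa}(\hat Y)) = \mathbb E(Y\mid \mathrm{Pa}(\hat Y))$ is optimal. (If $\hat Y$ is an ancestor of $Y$, this means that one function $\pi$ is the conditional expectation of $Y$ given the features in $\mathcal M_{\pi'}$ for every predictor $\pi'$, and is optimal.) The introduced total variation of $\pi$ is, in $\mathcal M_\pi$, $$\mathrm{ITV}=\bigl|\mathbb E(\hat Y\mid A=a_1)-\mathbb E(\hat Y\mid A=a_0)\bigr|-\bigl|\mathbb E(Y\mid A=a_1)-\mathbb E(Y\mid A=a_0)\bigr|.$$ A path is a sequence of distinct nodes with consecutive nodes joined by an edge in either direction. It is blocked by a set $Z$ of endogenous variables if it contains a non-collider in $Z$ or a collider that is neither in $Z$ nor an ancestor of a member of $Z$. Two nodes are d-connected given $Z$ if some path between them is not blocked by $Z$. A feature $W$ is requisite if it is d-connected to $U$ given $(\mathrm{Pa}(\hat Y)\cup\{\hat Y\})\setminus\{W\}$. **Theorem 2 (P-admissible ITV criterion).** Let $\mathcal G$ be an SL graph that is compatible with an SL SCM $\mathcal M$ for which $f_U$ is P-admissible and every optimal predictor has (a well-defined) $\mathrm{ITV}>0$.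 Then 1. there is a requisite feature $W\in\mathrm{Pa}(\hat Y)$ that is d-connected to $A$ (given $\emptyset$); 2. $A\notin\mathrm{Pa}(\hat Y)$; and 3. $A$ is d-connected to $U$ given $\mathrm{Pa}(\hat Y)$. -/

import Mathlib

open MeasureTheory ProbabilityTheory

/-! ### Causal graphs and d-separation -/

/-- An acyclic graph of a structural causal model with endogenous variables `V` and exogenous
variables `E`: `pa v` is the set of endogenous parents of `v`, and `exo v` is the set of exogenous
variables that enter the mechanism of `v`. An exogenous variable may enter several mechanisms, and
it has no parents. -/
structure CausalGraph (V E : Type*) where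
  pa : V → Set V
  exo : V → Set E
  acyclic : ∀ v, ¬ Relation.TransGen (fun u w => u ∈ pa w) v v

namespace CausalGraph

variable {V E : Type*} (G : CausalGraph V E)

/-- The edges of the graph; its nodes are all variables, endogenous and exogenous. -/
inductive Edge : V ⊕ E → V ⊕ E → Prop
  | endo {u v : V} : u ∈ G.pa v → Edge (Sum.inl u) (Sum.inl v)
  | exo {e : E} {v : V} : e ∈ G.exo v → Edge (Sum.inr e) (Sum.inl v)

/-- `p` is a path from `x` to `y`: a sequence of distinct nodes, consecutive ones being joined by
an edge in one of the two directions. -/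
def IsPath (p : List (V ⊕ E)) (x y : V ⊕ E) : Prop :=
  p.head? = some x ∧ p.getLast? = some y ∧ p.Nodup ∧
    p.IsChain (fun a b => G.Edge a b ∨ G.Edge b a)

/-- `b` is a collider on `p`: its two neighbours on `p` both have an edge into `b`. -/
def IsCollider (p : List (V ⊕ E)) (b : V ⊕ E) : Prop :=
  ∃ (l : List (V ⊕ E)) (a c : V ⊕ E) (r : List (V ⊕ E)),
    p = l ++ a :: b :: c :: r ∧ G.Edge a b ∧ G.Edge c b

/-- `p` is blocked by `Z`: it contains a non-collider in `Z`, or a collider that is neither in `Z`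
nor an ancestor of a member of `Z`. -/
def Blocked (p : List (V ⊕ E)) (Z : Set V) : Prop :=
  ∃ w ∈ p, (¬ G.IsCollider p w ∧ w ∈ Sum.inl '' Z) ∨
    (G.IsCollider p w ∧ ∀ z ∈ Z, ¬ Relation.ReflTransGen G.Edge w (Sum.inl z))

/-- `x` and `y` are d-connected given `Z`: some path between them is not blocked by `Z`. -/
def DConnected (x y : V) (Z : Set V) : Prop :=
  ∃ p : List (V ⊕ E), G.IsPath p (Sum.inl x) (Sum.inl y) ∧ ¬ G.Blocked p Z

theorem wellFounded [Finite V] : WellFounded (fun u w => u ∈ G.pa w) := by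
  have h : WellFounded (Relation.TransGen (fun u w => u ∈ G.pa w)) :=
    @Finite.wellFounded_of_trans_of_irrefl V _ _ ⟨fun _ _ _ => Relation.TransGen.trans⟩
      ⟨G.acyclic⟩
  exact Subrelation.wf (r := Relation.TransGen (fun u w => u ∈ G.pa w))
    (fun h => Relation.TransGen.single h) h

end CausalGraph

/-- The graph of a supervised learning model: the outcome `Y`, the prediction `Yhat`, the utility
variable `U`, whose arguments are exactly `Y` and `Yhat`, and the sensitive variable `A`. The
features are the members of `pa Yhat`. -/
structure SLGraph (V E : Type*) extends CausalGraph V E where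
  Y : V
  Yhat : V
  U : V
  A : V
  Y_ne_Yhat : Y ≠ Yhat
  A_ne_U : A ≠ U
  pa_U : pa U = {Y, Yhat}
  exo_U : exo U = ∅

/-- The set of features. -/
def SLGraph.features {V E : Type*} (G : SLGraph V E) : Set V := G.pa G.Yhat

/-- `W` is a requisite feature: it is d-connected to `U` given `Yhat` and the other features. -/
def SLGraph.Requisite {V E : Type*} (G : SLGraph V E) (W : V) : Prop :=
  W ∈ G.features ∧ G.DConnected W G.U ((G.features ∪ {G.Yhat}) \ {W})

/-! ### Structural causal models -/

/-- A structural causal model whose associated graph is `G`; `dom v` and `edom e` are the domains of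
the variables, `f v` is the mechanism of `v`, and the exogenous variables are independent, `e` having
the distribution `P e`. -/
structure SCM {V E : Type*} (G : CausalGraph V E) (dom : V → Type*) (edom : E → Type*)
    [∀ v, MeasurableSpace (dom v)] [∀ e, MeasurableSpace (edom e)] where
  f : ∀ v, ((w : G.pa v) → dom w) → ((e : G.exo v) → edom e) → dom v
  measurable_f : ∀ v, Measurable fun x : ((w : G.pa v) → dom w) × ((e : G.exo v) → edom e) =>
    f v x.1 x.2
  P : ∀ e, Measure (edom e)
  isProbabilityMeasure_P : ∀ e, IsProbabilityMeasure (P e)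

namespace SCM

variable {V E : Type*} {G : CausalGraph V E} {dom : V → Type*} {edom : E → Type*}
  [∀ v, MeasurableSpace (dom v)] [∀ e, MeasurableSpace (edom e)]

/-- The joint distribution of the exogenous variables. -/
noncomputable def law [Fintype E] (M : SCM G dom edom) : Measure (∀ e, edom e) := Measure.pi M.P

/-- The values of the endogenous variables as a function of those of the exogenous ones. -/
noncomputable def solve [Finite V] (M : SCM G dom edom) (ε : ∀ e, edom e) : ∀ v, dom v :=
  G.wellFounded.fix fun v ih => M.f v (fun w => ih w w.2) (fun e => ε e)

/-- The values satisfy the structural equations. -/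
theorem solve_eq [Finite V] (M : SCM G dom edom) (ε : ∀ e, edom e) (v : V) :
    M.solve ε v = M.f v (fun w => M.solve ε w) (fun e => ε e) :=
  G.wellFounded.fix_eq _ v

open Classical in
/-- The model in which the mechanism of `v` is replaced by a function `π` of the endogenous parents
of `v`. -/
noncomputable def replace (M : SCM G dom edom) (v : V) (π : ((w : G.pa v) → dom w) → dom v)
    (hπ : Measurable π) : SCM G dom edom where
  f := Function.update M.f v fun x _ => π x
  measurable_f := by
    intro u
    by_cases h : u = v
    · subst h
      simp only [Function.update_self]
      exact hπ.comp measurable_fst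
    · simpa [Function.update_of_ne h] using M.measurable_f u
  P := M.P
  isProbabilityMeasure_P := M.isProbabilityMeasure_P

end SCM

/-- A structural causal model over the graph of a supervised learning model: the domains of `Y`,
`Yhat` and `U` are (identified with) Borel sets of real numbers, and the domain of `A` contains the
baseline value `a₀` and the marginalised value `a₁`. -/
structure SLSCM {V E : Type*} (G : SLGraph V E) (dom : V → Type*) (edom : E → Type*)
    [∀ v, MeasurableSpace (dom v)] [∀ e, MeasurableSpace (edom e)] extends
    SCM G.toCausalGraph dom edom where
  realY : dom G.Y → ℝ
  realYhat : dom G.Yhat → ℝ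
  realU : dom G.U → ℝ
  measurableEmbedding_realY : MeasurableEmbedding realY
  measurableEmbedding_realYhat : MeasurableEmbedding realYhat
  measurableEmbedding_realU : MeasurableEmbedding realU
  a₀ : dom G.A
  a₁ : dom G.A
  measurableSet_a₀ : MeasurableSet ({a₀} : Set (dom G.A))
  measurableSet_a₁ : MeasurableSet ({a₁} : Set (dom G.A))

namespace SLSCM

variable {V E : Type*} [Finite V] [Fintype E] {G : SLGraph V E} {dom : V → Type*}
  {edom : E → Type*} [∀ v, MeasurableSpace (dom v)] [∀ e, MeasurableSpace (edom e)]

/-- A predictor: a (measurable) map from the feature values to the domain of `Yhat`. -/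
abbrev Predictor (_M : SLSCM G dom edom) : Type _ :=
  {π : ((w : G.features) → dom w) → dom G.Yhat // Measurable π}

variable (M : SLSCM G dom edom) (π : M.Predictor)

/-- The value of the variable `v` in the model with predictor `π`, as a random variable on the
space of the exogenous variables. -/
noncomputable def val (v : V) (ε : ∀ e, edom e) : dom v :=
  (M.replace G.Yhat π.1 π.2).solve ε v

/-- The features in the model with predictor `π`. -/
noncomputable def feat (ε : ∀ e, edom e) : (w : G.features) → dom w := fun w => M.val π w ε

/-- The real-valued random variable `Y`. -/
noncomputable def outcome (ε : ∀ e, edom e) : ℝ := M.realY (M.val π G.Y ε)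

/-- The real-valued random variable `Yhat`. -/
noncomputable def prediction (ε : ∀ e, edom e) : ℝ := M.realYhat (M.val π G.Yhat ε)

/-- The real-valued random variable `U`. -/
noncomputable def utility (ε : ∀ e, edom e) : ℝ := M.realU (M.val π G.U ε)

/-- The expected utility of `π`, as the difference of the expectations of the positive and the
negative part, with the value `⊥` where both are infinite. -/
noncomputable def expectedUtility : EReal :=
  ((∫⁻ ε, ENNReal.ofReal (M.utility π ε) ∂M.law : ENNReal) : EReal) -
    ((∫⁻ ε, ENNReal.ofReal (-M.utility π ε) ∂M.law : ENNReal) : EReal)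

/-- `π` is optimal: its expected utility exists, is finite, and is largest among all predictors. -/
def Optimal : Prop :=
  Integrable (M.utility π) M.law ∧ ∀ π' : M.Predictor, M.expectedUtility π' ≤ M.expectedUtility π

/-- The loss is P-admissible: the conditional expectation `E(Y | features)` is (almost surely
defined and) an optimal predictor. The law of `(Y, features)` does not depend on the predictor that
is in place unless `Yhat` is an ancestor of `Y`; in that case it is understood that one and the same
function gives the conditional expectation for all predictors. -/
def PAdmissible : Prop :=
  ∃ π : M.Predictor, M.Optimal π ∧ ∀ π' : M.Predictor,
    Integrable (M.outcome π') M.law ∧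
    (fun ε => M.realYhat (π.1 (M.feat π' ε))) =ᵐ[M.law]
      M.law[M.outcome π' | MeasurableSpace.comap (M.feat π') inferInstance]

/-- The event `A = a` in the model with predictor `π`. -/
def group (a : dom G.A) : Set (∀ e, edom e) := {ε | M.val π G.A ε = a}

/-- `E(X | A = a)` is defined: `A = a` has positive probability, and `X` is integrable given it. -/
def GroupMeanDefined (X : (∀ e, edom e) → ℝ) (a : dom G.A) : Prop :=
  M.law (M.group π a) ≠ 0 ∧ Integrable X (M.law[|M.group π a])

/-- The average total variation `E(X | A = a₁) - E(X | A = a₀)`. -/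
noncomputable def ATV (X : (∀ e, edom e) → ℝ) : ℝ :=
  (∫ ε, X ε ∂(M.law[|M.group π M.a₁])) - ∫ ε, X ε ∂(M.law[|M.group π M.a₀])

/-- The introduced total variation of the model with predictor `π`. -/
noncomputable def ITV : ℝ :=
  |M.ATV π (M.prediction π)| - |M.ATV π (M.outcome π)|

/-- The conditional expectations in the introduced total variation are defined. -/
def ITVDefined : Prop :=
  ∀ a ∈ ({M.a₀, M.a₁} : Set (dom G.A)),
    M.GroupMeanDefined π (M.prediction π) a ∧ M.GroupMeanDefined π (M.outcome π) a

end SLSCM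

/-! By P-admissibility the predictor `π` that computes E(Y | features) is optimal, so its ITV is
positive. If adding A to the features does not change this conditional expectation, the tower
property makes the means of Yhat and Y agree on every group A = a, and the ITV vanishes
(`SLSCM.ITV_eq_zero`). This rules out A as a feature, trivially, and rules out d-separation of A
from U given the features.

If no requisite feature is d-connected to A, then E(Y | features) reduces to the requisite features.
Those share no exogenous ancestor with A, so Yhat has equal group means and ITV ≤ 0. Requisiteness
also conditions on Yhat, so the reduction is made under a constant predictor, where Yhat carries no
information; P-admissibility says that the same `π` gives the conditional expectation there.

Both arguments need soundness of d-separation. Inside an ancestral set, delete the edges leaving Z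
and take a connected component. A component containing both variables yields an unblocked path
(`CausalGraph.Linked.dConnected`). Otherwise it splits the exogenous variables into two families
that are conditionally independent given Z (`SCM.Separates.condIndepSigma`), and each variable is a
function of Z and the family on its own side. -/

/-! ### Loop erasure and interior points of lists -/

theorem Relation.ReflTransGen.exists_nodup_isChain {α : Type*} {r : α → α → Prop} {x y : α}
    (h : Relation.ReflTransGen r x y) :
    ∃ p : List α, p.head? = some x ∧ p.getLast? = some y ∧ p.Nodup ∧ p.IsChain r := by
  induction h using Relation.ReflTransGen.head_induction_on with
  | refl => exact ⟨[y], by simp⟩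
  | @head a b hab _ ih =>
    obtain ⟨p, hb, hy, hnd, hc⟩ := ih
    by_cases ha : a ∈ p
    · obtain ⟨s, t, rfl⟩ := List.append_of_mem ha
      refine ⟨a :: t, rfl, ?_, hnd.of_append_right, hc.right_of_append⟩
      rw [← hy, List.getLast?_append_of_ne_nil _ (by simp)]
    · refine ⟨a :: p, rfl, ?_, List.nodup_cons.2 ⟨ha, hnd⟩, ?_⟩
      · rw [List.getLast?_cons, hy]; rfl
      · rw [List.isChain_cons]
        refine ⟨fun z hz => ?_, hc⟩
        rw [hb] at hz
        obtain rfl : b = z := by simpa using hz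
        exact hab

theorem List.exists_eq_append_neighbours {α : Type*} {p : List α} {b : α} (hb : b ∈ p)
    (hhead : p.head? ≠ some b) (hlast : p.getLast? ≠ some b) :
    ∃ l a c r, p = l ++ a :: b :: c :: r := by
  obtain ⟨s, t, rfl⟩ := List.append_of_mem hb
  rcases List.eq_nil_or_concat s with rfl | ⟨l, a, rfl⟩
  · simp at hhead
  rcases t with _ | ⟨c, r⟩
  · simp at hlast
  exact ⟨l, a, c, r, by simp⟩

/-! ### From walks avoiding tails in Z to unblocked paths -/

namespace CausalGraph

variable {V E : Type*} (G : CausalGraph V E)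

/-- The nodes with a directed path into `Z`, including the members of `Z`. -/
def ancestors (Z : Set V) : Set (V ⊕ E) :=
  {w | ∃ z ∈ Z, Relation.ReflTransGen G.Edge w (Sum.inl z)}

/-- Adjacency along an edge whose tail is not in `Z`. -/
def TailAdj (Z : Set V) (a b : V ⊕ E) : Prop :=
  (G.Edge a b ∧ a ∉ Sum.inl '' Z) ∨ (G.Edge b a ∧ b ∉ Sum.inl '' Z)

/-- `x` and `y` are joined by a walk with nodes in `D` all of whose edges have tails outside
`Z`. -/
def Linked (D : Set (V ⊕ E)) (Z : Set V) : V ⊕ E → V ⊕ E → Prop :=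
  Relation.ReflTransGen fun a b => G.TailAdj Z a b ∧ b ∈ D

variable {G}

theorem Edge.exists_inl {a b : V ⊕ E} (h : G.Edge a b) : ∃ v, b = Sum.inl v := by
  cases h <;> exact ⟨_, rfl⟩

theorem Edge.mem_pa {u v : V} (h : G.Edge (Sum.inl u) (Sum.inl v)) : u ∈ G.pa v := by
  cases h; assumption

/-- Exogenous nodes have no incoming edges, so a directed walk that starts at an endogenous node
stays endogenous; this transfers acyclicity to the full graph. -/
theorem transGen_pa {a b : V ⊕ E} (h : Relation.TransGen G.Edge a b) :
    ∀ u, a = Sum.inl u → ∃ v, b = Sum.inl v ∧ Relation.TransGen (fun u w => u ∈ G.pa w) u v := by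
  rintro u rfl
  induction h with
  | single h =>
    obtain ⟨v, rfl⟩ := h.exists_inl
    exact ⟨v, rfl, .single h.mem_pa⟩
  | tail _ h ih =>
    obtain ⟨w, rfl, hw⟩ := ih
    obtain ⟨v, rfl⟩ := h.exists_inl
    exact ⟨v, rfl, hw.tail h.mem_pa⟩

theorem not_transGen_edge_self (a : V ⊕ E) : ¬ Relation.TransGen G.Edge a a := by
  intro h
  rcases a with u | e
  · obtain ⟨v, hv, h⟩ := transGen_pa h u rfl
    cases hv
    exact G.acyclic u h
  · obtain ⟨_, -, h⟩ := Relation.TransGen.tail'_iff.1 h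
    obtain ⟨v, hv⟩ := h.exists_inl
    cases hv

theorem Edge.asymm {a b : V ⊕ E} (h : G.Edge a b) : ¬ G.Edge b a := fun h' =>
  not_transGen_edge_self a (.tail (.single h) h')

theorem ancestors_of_edge {Z : Set V} {a b : V ⊕ E} (h : G.Edge a b) (hb : b ∈ G.ancestors Z) :
    a ∈ G.ancestors Z :=
  hb.imp fun _ hz => ⟨hz.1, hz.2.head h⟩

theorem mem_ancestors {Z : Set V} {z : V} (hz : z ∈ Z) : Sum.inl z ∈ G.ancestors Z :=
  ⟨z, hz, .refl⟩

theorem ancestors_mono {Z Z' : Set V} (h : Z ⊆ Z') : G.ancestors Z ⊆ G.ancestors Z' :=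
  fun _ ⟨z, hz, hw⟩ => ⟨z, h hz, hw⟩

theorem notMem_of_notMem_ancestors {Z : Set V} {a : V ⊕ E} (h : a ∉ G.ancestors Z) :
    a ∉ Sum.inl '' Z := by
  rintro ⟨z, hz, rfl⟩
  exact h (mem_ancestors hz)

theorem TailAdj.mono {Z Z' : Set V} (h : Z' ⊆ Z) {a b : V ⊕ E} (hab : G.TailAdj Z a b) :
    G.TailAdj Z' a b :=
  hab.imp (fun h' => ⟨h'.1, fun h'' => h'.2 (Set.image_mono h h'')⟩)
    (fun h' => ⟨h'.1, fun h'' => h'.2 (Set.image_mono h h'')⟩)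

theorem TailAdj.symm {Z : Set V} {a b : V ⊕ E} (hab : G.TailAdj Z a b) : G.TailAdj Z b a :=
  hab.elim Or.inr Or.inl

theorem Linked.mono {D D' : Set (V ⊕ E)} {Z Z' : Set V} (hD : D ⊆ D') (h : Z' ⊆ Z) {a b : V ⊕ E}
    (hab : G.Linked D Z a b) : G.Linked D' Z' a b :=
  Relation.ReflTransGen.mono (fun _ _ h' => ⟨h'.1.mono h, hD h'.2⟩) _ _ hab

/-- A walk between `x` and `y` in the ancestral set of `{x, y} ∪ Z` on which the members of `Z`
have no outgoing edges yields a path that is not blocked by `Z`. -/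
theorem Linked.dConnected {x y : V} {Z : Set V} {D : Set (V ⊕ E)}
    (hD : D ⊆ G.ancestors ({x, y} ∪ Z)) (hx : x ∉ Z) (hy : y ∉ Z)
    (h : G.Linked D Z (Sum.inl x) (Sum.inl y)) : G.DConnected x y Z := by
  -- A collider in `K` is harmless. `P` and `Q` collect the remaining nodes, as ancestors of `x`
  -- and, failing that, of `y`.
  set K := G.ancestors Z with hK
  set P : Set (V ⊕ E) := G.ancestors {x} \ K with hP
  set Q : Set (V ⊕ E) := (G.ancestors {y} \ K) \ G.ancestors {x} with hQ
  have hcover : ∀ a ∈ D, a ∈ K ∨ a ∈ P ∨ a ∈ Q := by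
    intro a ha
    by_cases hK' : a ∈ K
    · exact Or.inl hK'
    by_cases hx' : a ∈ G.ancestors {x}
    · exact Or.inr (Or.inl ⟨hx', hK'⟩)
    obtain ⟨z, hz, hw⟩ := hD ha
    rcases hz with (rfl | rfl) | hz
    · exact absurd ⟨z, rfl, hw⟩ hx'
    · exact Or.inr (Or.inr ⟨⟨⟨z, rfl, hw⟩, hK'⟩, hx'⟩)
    · exact absurd ⟨z, hz, hw⟩ hK'
  -- A step of `R` enters `P` only against an edge and leaves `Q` only along one, so neither set can
  -- contain a collider. These are conditions on single steps, hence they survive loop erasure.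
  let R : V ⊕ E → V ⊕ E → Prop := fun a b =>
    G.TailAdj Z a b ∧ (a ∈ K ∨ a ∈ P ∨ a ∈ Q) ∧ (b ∈ K ∨ b ∈ P ∨ b ∈ Q) ∧
      (b ∈ P → G.Edge b a) ∧ (a ∈ Q → G.Edge a b)
  have hPreach : ∀ a ∈ P, Relation.ReflTransGen R (Sum.inl x) a := by
    rintro a ⟨⟨z, hz, haz⟩, haK⟩
    obtain rfl : z = x := hz
    clear hx h hD hcover
    induction haz using Relation.ReflTransGen.head_induction_on with
    | refl => exact .refl
    | @head a b hab hb ih =>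
      have hbK : b ∉ K := fun hbK => haK (ancestors_of_edge hab hbK)
      have haP : a ∈ P := ⟨⟨z, rfl, hb.head hab⟩, haK⟩
      have hbP : b ∈ P := ⟨⟨z, rfl, hb⟩, hbK⟩
      exact (ih hbK).tail ⟨Or.inr ⟨hab, notMem_of_notMem_ancestors haK⟩, Or.inr (Or.inl hbP),
        Or.inr (Or.inl haP), fun _ => hab, fun hbQ => absurd hbP.1 hbQ.2⟩
  have hQreach : ∀ a ∈ Q, Relation.ReflTransGen R a (Sum.inl y) := by
    rintro a ⟨⟨⟨z, hz, haz⟩, haK⟩, hax⟩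
    obtain rfl : z = y := hz
    clear hy h hD hcover
    induction haz using Relation.ReflTransGen.head_induction_on with
    | refl => exact .refl
    | @head a b hab hb ih =>
      have hbK : b ∉ K := fun hbK => haK (ancestors_of_edge hab hbK)
      have hbx : b ∉ G.ancestors {x} := fun hbx => hax (ancestors_of_edge hab hbx)
      have haQ : a ∈ Q := ⟨⟨⟨z, rfl, hb.head hab⟩, haK⟩, hax⟩
      have hbQ : b ∈ Q := ⟨⟨⟨z, rfl, hb⟩, hbK⟩, hbx⟩
      exact (ih hbx hbK).head ⟨Or.inl ⟨hab, notMem_of_notMem_ancestors haK⟩, Or.inr (Or.inr haQ),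
        Or.inr (Or.inr hbQ), fun hbP => absurd hbP.1 hbx, fun _ => hab⟩
  have hreach : Relation.ReflTransGen R (Sum.inl x) (Sum.inl y) := by
    have hxKP : Sum.inl x ∈ K ∨ Sum.inl x ∈ P := by
      by_cases hxK : Sum.inl x ∈ K
      · exact Or.inl hxK
      · exact Or.inr ⟨mem_ancestors rfl, hxK⟩
    -- Follow the given walk. On entering `P`, replace the initial part by a directed path into `x`
    -- traversed backwards; on entering `Q`, finish along a directed path to `y`.
    have key : ∀ b, G.Linked D Z (Sum.inl x) b → Relation.ReflTransGen R (Sum.inl x) (Sum.inl y) ∨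
        (Relation.ReflTransGen R (Sum.inl x) b ∧ (b ∈ K ∨ b ∈ P)) := by
      intro b hb
      induction hb with
      | refl => exact Or.inr ⟨.refl, hxKP⟩
      | @tail b c _ hbc ih =>
        rcases ih with ih | ⟨hb, hbKP⟩
        · exact Or.inl ih
        have hbQ : b ∉ Q := fun hbQ => hbKP.elim hbQ.1.2 fun hbP => hbQ.2 hbP.1
        have hbKPQ : b ∈ K ∨ b ∈ P ∨ b ∈ Q := hbKP.imp id Or.inl
        rcases hcover c hbc.2 with hc | hc | hc
        · exact Or.inr ⟨hb.tail ⟨hbc.1, hbKPQ, Or.inl hc, fun hcP => absurd hc hcP.2,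
            fun h => absurd h hbQ⟩, Or.inl hc⟩
        · exact Or.inr ⟨hPreach c hc, Or.inr hc⟩
        · exact Or.inl ((hb.tail ⟨hbc.1, hbKPQ, Or.inr (Or.inr hc),
            fun hcP => absurd hcP.1 hc.2, fun h => absurd h hbQ⟩).trans (hQreach c hc))
    rcases key _ h with h | h
    exacts [h, h.1]
  obtain ⟨p, hpx, hpy, hnd, hc⟩ := hreach.exists_nodup_isChain
  refine ⟨p, ⟨hpx, hpy, hnd, hc.imp fun a b hab => hab.1.imp And.left And.left⟩, ?_⟩
  have hsplit : ∀ {l a b c r}, p = l ++ a :: b :: c :: r → R a b ∧ R b c := by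
    intro l a b c r hp
    have := (hp ▸ hc).right_of_append
    simp only [List.isChain_cons_cons] at this
    exact ⟨this.1, this.2.1⟩
  -- A member of `Z` on the path is interior and is the tail of neither of its path edges, so it is
  -- a collider; every collider lies in `K`.
  rintro ⟨b, hb, ⟨hcol, hbZ⟩ | ⟨⟨l, a, c, r, hp, hab, hcb⟩, hbK⟩⟩
  · have hbx : p.head? ≠ some b := by
      rw [hpx]; rintro ⟨⟩
      obtain ⟨_, hz, hz'⟩ := hbZ; cases hz'; exact hx hz
    have hby : p.getLast? ≠ some b := by
      rw [hpy]; rintro ⟨⟩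
      obtain ⟨_, hz, hz'⟩ := hbZ; cases hz'; exact hy hz
    obtain ⟨l, a, c, r, hp⟩ := List.exists_eq_append_neighbours hb hbx hby
    obtain ⟨hab, hbc⟩ := hsplit hp
    refine hcol ⟨l, a, c, r, hp, ?_, ?_⟩
    · exact hab.1.elim And.left fun h => absurd hbZ h.2
    · exact hbc.1.elim (fun h => absurd hbZ h.2) And.left
  · obtain ⟨h₁, h₂⟩ := hsplit hp
    rcases h₂.2.1 with h | h | h
    · obtain ⟨z, hz, hw⟩ := h
      exact hbK z hz hw
    · exact hab.asymm (h₁.2.2.2.1 h)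
    · exact hcb.asymm (h₂.2.2.2.2 h)

/-- Two variables with a common ancestor are d-connected given the empty set. -/
theorem dConnected_empty_of_common_ancestor {x y : V} {w : V ⊕ E}
    (hx : Relation.ReflTransGen G.Edge w (Sum.inl x))
    (hy : Relation.ReflTransGen G.Edge w (Sum.inl y)) : G.DConnected x y ∅ := by
  refine Linked.dConnected (D := G.ancestors ({x, y} ∪ ∅)) subset_rfl (by simp) (by simp) ?_
  have h₁ : G.Linked (G.ancestors ({x, y} ∪ ∅)) ∅ (Sum.inl x) w := by
    clear hy
    induction hx using Relation.ReflTransGen.head_induction_on with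
    | refl => exact .refl
    | @head a b hab hb ih =>
      exact Relation.ReflTransGen.tail ih
        ⟨Or.inr ⟨hab, by simp⟩, x, by simp, hb.head hab⟩
  have h₂ : G.Linked (G.ancestors ({x, y} ∪ ∅)) ∅ w (Sum.inl y) := by
    clear hx h₁
    induction hy using Relation.ReflTransGen.head_induction_on with
    | refl => exact .refl
    | @head a b hab hb ih =>
      exact Relation.ReflTransGen.head ⟨Or.inl ⟨hab, by simp⟩, y, by simp, hb⟩ ih
  exact Relation.ReflTransGen.trans h₁ h₂

end CausalGraph

/-! ### Conditional independence of σ-algebras -/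

namespace MeasureTheory

variable {Ω : Type*}

theorem isPiSystem_inter_measurableSet (m₁ m₂ : MeasurableSpace Ω) :
    IsPiSystem {s | ∃ t u, MeasurableSet[m₁] t ∧ MeasurableSet[m₂] u ∧ s = t ∩ u} := by
  rintro _ ⟨t, u, ht, hu, rfl⟩ _ ⟨t', u', ht', hu', rfl⟩ -
  exact ⟨t ∩ t', u ∩ u', ht.inter ht', hu.inter hu', Set.inter_inter_inter_comm _ _ _ _⟩

theorem generateFrom_inter_measurableSet (m₁ m₂ : MeasurableSpace Ω) :
    m₁ ⊔ m₂ = MeasurableSpace.generateFrom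
      {s | ∃ t u, MeasurableSet[m₁] t ∧ MeasurableSet[m₂] u ∧ s = t ∩ u} := by
  apply le_antisymm
  · refine sup_le (fun s hs => ?_) fun s hs => ?_
    · exact MeasurableSpace.measurableSet_generateFrom ⟨s, Set.univ, hs, .univ, by simp⟩
    · exact MeasurableSpace.measurableSet_generateFrom ⟨Set.univ, s, .univ, hs, by simp⟩
  · refine MeasurableSpace.generateFrom_le ?_
    rintro _ ⟨t, u, ht, hu, rfl⟩
    exact MeasurableSet.inter ((le_sup_left : m₁ ≤ m₁ ⊔ m₂) _ ht)
      ((le_sup_right : m₂ ≤ m₁ ⊔ m₂) _ hu)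

variable {m m₀ m₁ m₂ : MeasurableSpace Ω} [mΩ : MeasurableSpace Ω] {μ : Measure Ω}

/-- A π-λ argument on the intersections `t ∩ u`; taking both sets to be everything supplies the
total integrals needed for complements. -/
theorem setIntegral_eq_of_sup (h₁ : m₁ ≤ mΩ) (h₂ : m₂ ≤ mΩ)
    {f g : Ω → ℝ} (hf : Integrable f μ) (hg : Integrable g μ)
    (h : ∀ t u, MeasurableSet[m₁] t → MeasurableSet[m₂] u →
      ∫ x in t ∩ u, f x ∂μ = ∫ x in t ∩ u, g x ∂μ)
    {s : Set Ω} (hs : MeasurableSet[m₁ ⊔ m₂] s) : ∫ x in s, f x ∂μ = ∫ x in s, g x ∂μ := by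
  have hle : m₁ ⊔ m₂ ≤ mΩ := sup_le h₁ h₂
  have huniv : ∫ x, f x ∂μ = ∫ x, g x ∂μ := by
    simpa using h Set.univ Set.univ .univ .univ
  induction s, hs using MeasurableSpace.induction_on_inter (generateFrom_inter_measurableSet m₁ m₂)
    (isPiSystem_inter_measurableSet m₁ m₂) with
  | empty => simp
  | basic s hs =>
    obtain ⟨t, u, ht, hu, rfl⟩ := hs
    exact h t u ht hu
  | compl s hs ih =>
    rw [setIntegral_compl (hle _ hs) hf, setIntegral_compl (hle _ hs) hg, ih, huniv]
  | iUnion s hd hs ih =>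
    rw [integral_iUnion (fun i => hle _ (hs i)) hd hf.integrableOn,
      integral_iUnion (fun i => hle _ (hs i)) hd hg.integrableOn]
    exact tsum_congr ih

theorem setIntegral_condExp_mul [IsFiniteMeasure μ] (hm : m ≤ mΩ)
    {f h : Ω → ℝ} (hf : Integrable f μ) (hh : StronglyMeasurable[m] h)
    (hfh : Integrable (fun x => f x * h x) μ) {s : Set Ω} (hs : MeasurableSet[m] s) :
    ∫ x in s, (μ[f|m]) x * h x ∂μ = ∫ x in s, f x * h x ∂μ := by
  rw [← setIntegral_condExp hm hfh hs]
  exact setIntegral_congr_ae (hm _ hs)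
    ((condExp_mul_of_stronglyMeasurable_right hh hfh hf).mono fun x hx _ => hx.symm)

theorem setIntegral_mul_condExp [IsFiniteMeasure μ] (hm : m ≤ mΩ)
    {f h : Ω → ℝ} (hf : Integrable f μ) (hh : StronglyMeasurable[m] h) {c : ℝ}
    (hc : ∀ᵐ x ∂μ, ‖h x‖ ≤ c) {s : Set Ω} (hs : MeasurableSet[m] s) :
    ∫ x in s, f x * h x ∂μ = ∫ x in s, (μ[f|m]) x * h x ∂μ :=
  (setIntegral_condExp_mul hm hf hh (hf.mul_bdd (hh.mono hm).aestronglyMeasurable hc) hs).symm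

theorem norm_condExp_indicator_le (m : MeasurableSpace Ω) (s : Set Ω) :
    ∀ᵐ x ∂μ, ‖(μ[s.indicator (1 : Ω → ℝ)|m]) x‖ ≤ 1 := by
  have := ae_bdd_abs_condExp_of_ae_bdd_abs (μ := μ) (m := m) (R := (1 : ℝ)) (f := s.indicator (1 : Ω → ℝ))
    (Filter.Eventually.of_forall fun x => by
      by_cases hx : x ∈ s <;> simp [hx])
  simpa using this

theorem integrable_indicator_one [IsFiniteMeasure μ] {s : Set Ω} (hs : MeasurableSet s) :
    Integrable (s.indicator (1 : Ω → ℝ)) μ :=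
  (integrable_const (1 : ℝ)).indicator hs

theorem setIntegral_inter_eq_mul_indicator {s t : Set Ω} (ht : MeasurableSet t) (f : Ω → ℝ) :
    ∫ x in s ∩ t, f x ∂μ = ∫ x in s, f x * t.indicator (1 : Ω → ℝ) x ∂μ := by
  rw [← setIntegral_indicator ht]
  congr 1 with x
  by_cases hx : x ∈ t <;> simp [hx]

variable (m₀ m₁ m₂ μ) in
/-- The σ-algebras `m₁` and `m₂` are conditionally independent given `m₀`. -/
def CondIndepSigma : Prop :=
  ∀ s, MeasurableSet[m₂] s →
    μ[s.indicator (1 : Ω → ℝ)|m₀ ⊔ m₁] =ᵐ[μ] μ[s.indicator (1 : Ω → ℝ)|m₀]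

/-- Test on `t ∩ u`. Conditional expectation given `m₀` is self-adjoint, so it can be moved from the
indicator of `s` to that of `u`, where the hypothesis applies. -/
theorem CondIndepSigma.symm [IsFiniteMeasure μ] (h₀ : m₀ ≤ mΩ) (h₁ : m₁ ≤ mΩ) (h₂ : m₂ ≤ mΩ)
    (h : CondIndepSigma m₀ m₁ m₂ μ) : CondIndepSigma m₀ m₂ m₁ μ := by
  intro s hs
  have hsi := integrable_indicator_one (μ := μ) (h₁ _ hs)
  symm
  refine ae_eq_condExp_of_forall_setIntegral_eq (sup_le h₀ h₂) hsi
    (fun _ _ _ => integrable_condExp.integrableOn) (fun t ht _ => ?_)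
    (stronglyMeasurable_condExp.mono (le_sup_left : m₀ ≤ m₀ ⊔ m₂)).aestronglyMeasurable
  refine setIntegral_eq_of_sup h₀ h₂ integrable_condExp hsi (fun t u ht hu => ?_) ht
  have hui := integrable_indicator_one (μ := μ) (h₂ _ hu)
  calc ∫ x in t ∩ u, (μ[s.indicator (1 : Ω → ℝ)|m₀]) x ∂μ
      = ∫ x in t, (u.indicator (1 : Ω → ℝ)) x * (μ[s.indicator (1 : Ω → ℝ)|m₀]) x ∂μ := by
        rw [setIntegral_inter_eq_mul_indicator (h₂ _ hu)]
        simp_rw [mul_comm]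
    _ = ∫ x in t, (μ[u.indicator (1 : Ω → ℝ)|m₀]) x * (μ[s.indicator (1 : Ω → ℝ)|m₀]) x ∂μ :=
        setIntegral_mul_condExp h₀ hui stronglyMeasurable_condExp
          (norm_condExp_indicator_le m₀ s) ht
    _ = ∫ x in t, s.indicator (1 : Ω → ℝ) x * (μ[u.indicator (1 : Ω → ℝ)|m₀]) x ∂μ := by
        rw [setIntegral_mul_condExp h₀ hsi stronglyMeasurable_condExp
          (norm_condExp_indicator_le m₀ u) ht]
        simp_rw [mul_comm]
    _ = ∫ x in t ∩ s, (μ[u.indicator (1 : Ω → ℝ)|m₀]) x ∂μ := by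
        rw [setIntegral_inter_eq_mul_indicator (h₁ _ hs)]
        simp_rw [mul_comm]
    _ = ∫ x in t ∩ s, (μ[u.indicator (1 : Ω → ℝ)|m₀ ⊔ m₁]) x ∂μ :=
        setIntegral_congr_ae ((h₀ _ ht).inter (h₁ _ hs)) ((h u hu).mono fun x hx _ => hx.symm)
    _ = ∫ x in t ∩ s, u.indicator (1 : Ω → ℝ) x ∂μ :=
        setIntegral_condExp (sup_le h₀ h₁) hui
          (MeasurableSet.inter ((le_sup_left : m₀ ≤ m₀ ⊔ m₁) _ ht)
            ((le_sup_right : m₁ ≤ m₀ ⊔ m₁) _ hs))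
    _ = ∫ x in t ∩ u, s.indicator (1 : Ω → ℝ) x ∂μ := by
        rw [setIntegral_indicator (h₂ _ hu), setIntegral_indicator (h₁ _ hs),
          Set.inter_assoc, Set.inter_assoc, Set.inter_comm s u]

/-- Information contained in `m₀ ⊔ m₁` can be added to the condition. -/
theorem CondIndepSigma.adjoin_left [IsFiniteMeasure μ] (h₀ : m₀ ≤ mΩ) (h₁ : m₁ ≤ mΩ)
    (hm : m ≤ m₀ ⊔ m₁) (h : CondIndepSigma m₀ m₁ m₂ μ) :
    CondIndepSigma (m₀ ⊔ m) m₁ m₂ μ := by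
  intro s hs
  have hle : m₀ ⊔ m ≤ m₀ ⊔ m₁ := sup_le le_sup_left hm
  have heq : m₀ ⊔ m ⊔ m₁ = m₀ ⊔ m₁ :=
    le_antisymm (sup_le hle le_sup_right) (sup_le_sup_right le_sup_left _)
  rw [heq]
  have h' : μ[s.indicator (1 : Ω → ℝ)|m₀ ⊔ m] =ᵐ[μ] μ[s.indicator (1 : Ω → ℝ)|m₀] :=
    calc μ[s.indicator (1 : Ω → ℝ)|m₀ ⊔ m]
        =ᵐ[μ] μ[μ[s.indicator (1 : Ω → ℝ)|m₀ ⊔ m₁]|m₀ ⊔ m] :=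
          (condExp_condExp_of_le hle (sup_le h₀ h₁)).symm
      _ =ᵐ[μ] μ[μ[s.indicator (1 : Ω → ℝ)|m₀]|m₀ ⊔ m] := condExp_congr_ae (h s hs)
      _ = μ[s.indicator (1 : Ω → ℝ)|m₀] :=
          condExp_of_stronglyMeasurable (hle.trans (sup_le h₀ h₁))
            (stronglyMeasurable_condExp.mono le_sup_left) integrable_condExp
  exact (h s hs).trans h'.symm

theorem CondIndepSigma.adjoin_right [IsFiniteMeasure μ] (h₀ : m₀ ≤ mΩ) (h₁ : m₁ ≤ mΩ)
    (h₂ : m₂ ≤ mΩ) (hm : m ≤ m₀ ⊔ m₂) (h : CondIndepSigma m₀ m₁ m₂ μ) :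
    CondIndepSigma (m₀ ⊔ m) m₁ m₂ μ :=
  ((h.symm h₀ h₁ h₂).adjoin_left h₀ h₂ hm).symm (sup_le h₀ (hm.trans (sup_le h₀ h₂))) h₂ h₁

/-- The self-adjointness argument again, now with an integrable `f` in place of an indicator; the
symmetric form of the hypothesis handles `u`. -/
theorem CondIndepSigma.condExp_eq [IsFiniteMeasure μ] (h₀ : m₀ ≤ mΩ) (h₁ : m₁ ≤ mΩ)
    (h₂ : m₂ ≤ mΩ) (h : CondIndepSigma m₀ m₁ m₂ μ) {f : Ω → ℝ} (hf : Integrable f μ)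
    (hfm : StronglyMeasurable[m₀ ⊔ m₂] f) : μ[f|m₀ ⊔ m₁] =ᵐ[μ] μ[f|m₀] := by
  symm
  refine ae_eq_condExp_of_forall_setIntegral_eq (sup_le h₀ h₁) hf
    (fun _ _ _ => integrable_condExp.integrableOn) (fun t ht _ => ?_)
    (stronglyMeasurable_condExp.mono (le_sup_left : m₀ ≤ m₀ ⊔ m₁)).aestronglyMeasurable
  refine setIntegral_eq_of_sup h₀ h₁ integrable_condExp hf (fun t u ht hu => ?_) ht
  have hui := integrable_indicator_one (μ := μ) (h₁ _ hu)
  have hle : m₀ ⊔ m₂ ≤ mΩ := sup_le h₀ h₂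
  have hb := norm_condExp_indicator_le (μ := μ) m₀ u
  have hind : Integrable (fun x => u.indicator (1 : Ω → ℝ) x * f x) μ := by
    refine hf.bdd_mul (c := 1) hui.aestronglyMeasurable (.of_forall fun x => ?_)
    by_cases hx : x ∈ u <;> simp [hx]
  calc ∫ x in t ∩ u, (μ[f|m₀]) x ∂μ
      = ∫ x in t, (u.indicator (1 : Ω → ℝ)) x * (μ[f|m₀]) x ∂μ := by
        rw [setIntegral_inter_eq_mul_indicator (h₁ _ hu)]
        simp_rw [mul_comm]
    _ = ∫ x in t, (μ[u.indicator (1 : Ω → ℝ)|m₀]) x * (μ[f|m₀]) x ∂μ := by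
        refine (setIntegral_condExp_mul h₀ hui stronglyMeasurable_condExp ?_ ht).symm
        refine integrable_condExp.bdd_mul (c := 1) hui.aestronglyMeasurable (.of_forall fun x => ?_)
        by_cases hx : x ∈ u <;> simp [hx]
    _ = ∫ x in t, f x * (μ[u.indicator (1 : Ω → ℝ)|m₀]) x ∂μ := by
        rw [setIntegral_mul_condExp h₀ hf stronglyMeasurable_condExp hb ht]
        simp_rw [mul_comm]
    _ = ∫ x in t, (μ[u.indicator (1 : Ω → ℝ)|m₀ ⊔ m₂]) x * f x ∂μ := by
        refine setIntegral_congr_ae (h₀ _ ht) (((h.symm h₀ h₁ h₂) u hu).mono fun x hx _ => ?_)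
        rw [hx, mul_comm]
    _ = ∫ x in t, u.indicator (1 : Ω → ℝ) x * f x ∂μ :=
        setIntegral_condExp_mul hle hui hfm hind ((le_sup_left : m₀ ≤ m₀ ⊔ m₂) _ ht)
    _ = ∫ x in t ∩ u, f x ∂μ := by
        rw [setIntegral_inter_eq_mul_indicator (h₁ _ hu)]
        simp_rw [mul_comm]

theorem condIndepSigma_bot [IsProbabilityMeasure μ] (h₁ : m₁ ≤ mΩ) (h₂ : m₂ ≤ mΩ)
    (h : Indep m₁ m₂ μ) : CondIndepSigma ⊥ m₁ m₂ μ := by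
  intro s hs
  rw [bot_sup_eq, condExp_bot]
  exact condExp_indep_eq h₂ h₁ ((stronglyMeasurable_const (b := (1 : ℝ))).indicator hs) h.symm

end MeasureTheory

/-! ### Separations in a structural causal model -/

namespace SCM

variable {V E : Type*} {G : CausalGraph V E} {dom : V → Type*} {edom : E → Type*}
  [∀ v, MeasurableSpace (dom v)] [∀ e, MeasurableSpace (edom e)]

instance [Fintype E] (M : SCM G dom edom) : IsProbabilityMeasure M.law :=
  haveI := M.isProbabilityMeasure_P
  inferInstanceAs (IsProbabilityMeasure (Measure.pi M.P))

/-- The σ-algebra generated by the exogenous variables in `S`. -/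
@[reducible]
def sigmaExo (edom : E → Type*) [∀ e, MeasurableSpace (edom e)] (S : Set E) :
    MeasurableSpace (∀ e, edom e) :=
  ⨆ e ∈ S, MeasurableSpace.comap (fun ε => ε e) inferInstance

theorem measurable_sigmaExo {S : Set E} {e : E} (he : e ∈ S) :
    Measurable[sigmaExo edom S] fun ε : ∀ e, edom e => ε e :=
  (comap_measurable _).mono
    (le_iSup₂ (f := fun e (_ : e ∈ S) =>
      MeasurableSpace.comap (fun ε : ∀ e, edom e => ε e) inferInstance) e he) le_rfl

theorem sigmaExo_le (S : Set E) : sigmaExo edom S ≤ MeasurableSpace.pi :=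
  iSup₂_le fun e _ => (measurable_pi_apply e).comap_le

theorem indep_sigmaExo [Fintype E] (M : SCM G dom edom) {S T : Set E} (h : Disjoint S T) :
    Indep (sigmaExo edom S) (sigmaExo edom T) M.law := by
  have := M.isProbabilityMeasure_P
  have hind : iIndepFun (fun (e : E) (ε : ∀ e, edom e) => ε e) M.law :=
    iIndepFun_pi (μ := M.P) (X := fun _ => id) fun _ => aemeasurable_id
  exact indep_iSup_of_disjoint (fun e => (measurable_pi_apply e).comap_le) hind h

/-- `C` separates the variables of the ancestral set `D` given `Z`: the members of
`D` and their parents outside `Z` lie on the same side. -/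
structure Separates {V E : Type*} (G : CausalGraph V E) (D Z : Set V) (C : Set (V ⊕ E)) : Prop where
  pa_subset : ∀ v ∈ D, G.pa v ⊆ D
  subset : Z ⊆ D
  endo_iff : ∀ v ∈ D, ∀ u ∈ G.pa v, u ∉ Z → (Sum.inl u ∈ C ↔ Sum.inl v ∈ C)
  exo_iff : ∀ v ∈ D, ∀ e ∈ G.exo v, (Sum.inr e ∈ C ↔ Sum.inl v ∈ C)

theorem Separates.compl {D Z : Set V} {C : Set (V ⊕ E)} (h : Separates G D Z C) : Separates G D Z Cᶜ where
  pa_subset := h.pa_subset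
  subset := h.subset
  endo_iff v hv u hu huZ := not_congr (h.endo_iff v hv u hu huZ)
  exo_iff v hv e he := not_congr (h.exo_iff v hv e he)

variable [Finite V] (M : SCM G dom edom)

/-- The σ-algebra generated by the endogenous variables in `T`. -/
@[reducible]
noncomputable def sigmaEndo (T : Set V) : MeasurableSpace (∀ e, edom e) :=
  ⨆ v ∈ T, MeasurableSpace.comap (fun ε => M.solve ε v) inferInstance

theorem measurable_sigmaEndo {T : Set V} {v : V} (hv : v ∈ T) :
    Measurable[M.sigmaEndo T] fun ε => M.solve ε v :=
  (comap_measurable _).mono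
    (le_iSup₂ (f := fun v (_ : v ∈ T) =>
      MeasurableSpace.comap (fun ε => M.solve ε v) inferInstance) v hv) le_rfl

theorem sigmaEndo_le {T : Set V} {m : MeasurableSpace (∀ e, edom e)}
    (h : ∀ v ∈ T, Measurable[m] fun ε => M.solve ε v) : M.sigmaEndo T ≤ m :=
  iSup₂_le fun v hv => (h v hv).comap_le

theorem sigmaEndo_mono {S T : Set V} (h : S ⊆ T) : M.sigmaEndo S ≤ M.sigmaEndo T :=
  M.sigmaEndo_le fun _ hv => M.measurable_sigmaEndo (h hv)

theorem sigmaEndo_union (S T : Set V) :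
    M.sigmaEndo (S ∪ T) = M.sigmaEndo S ⊔ M.sigmaEndo T :=
  iSup_union

/-- Variables whose mechanisms only involve measurable variables and each other are measurable. -/
theorem measurable_solve_of_parents {m : MeasurableSpace (∀ e, edom e)} {S : Set V}
    (hendo : ∀ v ∈ S, ∀ u ∈ G.pa v, u ∈ S ∨ Measurable[m] fun ε => M.solve ε u)
    (hexo : ∀ v ∈ S, ∀ e ∈ G.exo v, Measurable[m] fun ε : ∀ e, edom e => ε e) :
    ∀ v ∈ S, Measurable[m] fun ε => M.solve ε v := by
  intro v
  induction v using G.wellFounded.induction with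
  | _ v ih =>
    intro hv
    simp_rw [M.solve_eq _ v]
    refine (M.measurable_f v).comp (Measurable.prodMk ?_ ?_)
    · refine measurable_pi_lambda _ fun w => ?_
      exact (hendo v hv w w.2).elim (fun h => ih w w.2 h) id
    · exact measurable_pi_lambda _ fun e => hexo v hv e e.2

theorem measurable_solve (v : V) : Measurable fun ε => M.solve ε v :=
  M.measurable_solve_of_parents (S := Set.univ) (fun _ _ _ _ => Or.inl trivial)
    (fun _ _ e _ => measurable_pi_apply e) v trivial

theorem sigmaEndo_le_pi (T : Set V) : M.sigmaEndo T ≤ MeasurableSpace.pi :=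
  M.sigmaEndo_le fun v _ => M.measurable_solve v

theorem measurable_sigmaExo_ancestors (v : V) :
    Measurable[sigmaExo edom {e | Relation.ReflTransGen G.Edge (Sum.inr e) (Sum.inl v)}]
      fun ε => M.solve ε v :=
  M.measurable_solve_of_parents
    (S := {u | Relation.ReflTransGen G.Edge (Sum.inl u) (Sum.inl v)})
    (fun _ hw _ hu => Or.inl (Relation.ReflTransGen.head (.endo hu) hw))
    (fun _ hw _ he => measurable_sigmaExo (Relation.ReflTransGen.head (.exo he) hw)) v .refl

variable {D Z : Set V} {C : Set (V ⊕ E)}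

/-- Unfolding the structural equations backwards from `v` stays on the side of `v` until it meets
`Z`, and meets only proper ancestors of `v` there. So `T` need not contain `v`, even when `v` is in
`Z`. -/
theorem Separates.measurable_solve (h : Separates G D Z C) {T : Set V} {v : V} (hv : v ∈ D)
    (hvC : Sum.inl v ∈ C)
    (hvT : ∀ u ∈ Z, Relation.TransGen (fun u w => u ∈ G.pa w) u v → u ∈ T) :
    Measurable[M.sigmaEndo T ⊔ sigmaExo edom {e | Sum.inr e ∈ C}] fun ε => M.solve ε v := by
  refine M.measurable_solve_of_parents (S := {w | w ∈ D ∧ Sum.inl w ∈ C ∧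
    ∀ u ∈ Z, Relation.TransGen (fun u w => u ∈ G.pa w) u w → u ∈ T}) ?_ ?_ v ⟨hv, hvC, hvT⟩
  · rintro w ⟨hw, hwC, hwT⟩ u hu
    by_cases huZ : u ∈ Z
    · exact Or.inr ((M.measurable_sigmaEndo (hwT u huZ (.single hu))).mono le_sup_left le_rfl)
    · exact Or.inl ⟨h.pa_subset w hw hu, (h.endo_iff w hw u hu huZ).2 hwC,
        fun t ht htu => hwT t ht (htu.tail hu)⟩
  · rintro w ⟨hw, hwC, -⟩ e he
    exact (measurable_sigmaExo (S := {e | Sum.inr e ∈ C}) ((h.exo_iff w hw e he).2 hwC)).mono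
      le_sup_right le_rfl

variable [Fintype E]

/-- Exogenous families on the two sides are independent before conditioning. Members of `Z` are then
added in causal order: each is a function of earlier ones and of one side's exogenous variables, so
conditioning on it preserves conditional independence. -/
theorem Separates.condIndepSigma (h : Separates G D Z C) :
    CondIndepSigma (M.sigmaEndo Z) (sigmaExo edom {e | Sum.inr e ∈ C})
      (sigmaExo edom {e | Sum.inr e ∈ Cᶜ}) M.law := by
  suffices H : ∀ n : ℕ, ∀ T ⊆ Z, T.ncard = n →
      (∀ v ∈ T, ∀ u ∈ Z, Relation.TransGen (fun u w => u ∈ G.pa w) u v → u ∈ T) →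
      CondIndepSigma (M.sigmaEndo T) (sigmaExo edom {e | Sum.inr e ∈ C})
        (sigmaExo edom {e | Sum.inr e ∈ Cᶜ}) M.law from
    H _ Z subset_rfl rfl fun _ _ u hu _ => hu
  intro n
  induction n with
  | zero =>
    intro T _ hT _
    obtain rfl : T = ∅ := (Set.ncard_eq_zero T.toFinite).1 hT
    have hbot : M.sigmaEndo ∅ = ⊥ := by simp [sigmaEndo]
    rw [hbot]
    refine condIndepSigma_bot (sigmaExo_le _) (sigmaExo_le _) (M.indep_sigmaExo ?_)
    exact Set.disjoint_left.2 fun e he he' => he' he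
  | succ n ih =>
    intro T hTZ hT hlow
    have hne : T.Nonempty := by
      rw [Set.nonempty_iff_ne_empty]; rintro rfl; simp at hT
    -- The order is reversed: a minimal `v` has no descendant in `T`, so `T \ {v}` still contains
    -- all `Z`-ancestors of its members.
    have hwf : WellFounded (fun u v => Relation.TransGen (fun u w => u ∈ G.pa w) v u) :=
      @Finite.wellFounded_of_trans_of_irrefl V _ _ ⟨fun _ _ _ h₁ h₂ => h₂.trans h₁⟩ ⟨G.acyclic⟩
    obtain ⟨v, hvT, hmax⟩ := hwf.has_min T hne
    have hlow' : ∀ u ∈ Z, Relation.TransGen (fun u w => u ∈ G.pa w) u v → u ∈ T \ {v} := by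
      refine fun u hu huv => ⟨hlow v hvT u hu huv, ?_⟩
      rintro rfl
      exact G.acyclic _ huv
    have hih := ih (T \ {v}) (Set.sdiff_subset.trans hTZ)
      (by rw [Set.ncard_sdiff_singleton_of_mem hvT, hT]; rfl) (by
        rintro w ⟨hwT, -⟩ u hu huw
        refine ⟨hlow w hwT u hu huw, ?_⟩
        rintro rfl
        exact hmax w hwT huw)
    have hsup : M.sigmaEndo T = M.sigmaEndo (T \ {v}) ⊔
        MeasurableSpace.comap (fun ε => M.solve ε v) inferInstance := by
      have h1 : M.sigmaEndo {v} = MeasurableSpace.comap (fun ε => M.solve ε v) inferInstance := by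
        simp [sigmaEndo]
      rw [← h1, ← sigmaEndo_union, Set.sdiff_union_self, Set.union_eq_self_of_subset_right]
      simpa using hvT
    rw [hsup]
    have hvD := h.subset (hTZ hvT)
    by_cases hvC : Sum.inl v ∈ C
    · exact hih.adjoin_left (M.sigmaEndo_le_pi _) (sigmaExo_le _)
        (h.measurable_solve M hvD hvC hlow').comap_le
    · exact hih.adjoin_right (M.sigmaEndo_le_pi _) (sigmaExo_le _) (sigmaExo_le _)
        (h.compl.measurable_solve M hvD hvC hlow').comap_le

/-- Variables on one side of a separation carry no information, beyond that in `Z`, on a variable on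
the other side. -/
theorem Separates.condExp_eq (h : Separates G D Z C) {S : Set V} (hSD : S ⊆ D)
    (hSC : ∀ w ∈ S, w ∈ Z ∨ Sum.inl w ∈ C) {y : V} (hy : y ∈ D) (hyC : Sum.inl y ∉ C)
    {g : dom y → ℝ} (hg : Measurable g) (hint : Integrable (fun ε => g (M.solve ε y)) M.law) :
    M.law[fun ε => g (M.solve ε y)|M.sigmaEndo (Z ∪ S)] =ᵐ[M.law]
      M.law[fun ε => g (M.solve ε y)|M.sigmaEndo Z] := by
  have hle : M.sigmaEndo (Z ∪ S) ≤ M.sigmaEndo Z ⊔ sigmaExo edom {e | Sum.inr e ∈ C} := by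
    rw [sigmaEndo_union]
    refine sup_le le_sup_left (M.sigmaEndo_le fun w hw => ?_)
    rcases hSC w hw with hwZ | hwC
    · exact (M.measurable_sigmaEndo hwZ).mono le_sup_left le_rfl
    · exact h.measurable_solve M (hSD hw) hwC fun _ hu _ => hu
  have hZ := M.sigmaEndo_le_pi Z
  have hC := sigmaExo_le (edom := edom) {e | Sum.inr e ∈ C}
  have key := (h.condIndepSigma M).condExp_eq hZ hC (sigmaExo_le _) hint
    (hg.comp (h.compl.measurable_solve M hy hyC fun _ hu _ => hu)).stronglyMeasurable
  calc M.law[fun ε => g (M.solve ε y)|M.sigmaEndo (Z ∪ S)]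
      =ᵐ[M.law] M.law[M.law[fun ε => g (M.solve ε y)|
          M.sigmaEndo Z ⊔ sigmaExo edom {e | Sum.inr e ∈ C}]|M.sigmaEndo (Z ∪ S)] :=
        (condExp_condExp_of_le hle (sup_le hZ hC)).symm
    _ =ᵐ[M.law] M.law[M.law[fun ε => g (M.solve ε y)|M.sigmaEndo Z]|M.sigmaEndo (Z ∪ S)] :=
        condExp_congr_ae key
    _ = M.law[fun ε => g (M.solve ε y)|M.sigmaEndo Z] :=
        condExp_of_stronglyMeasurable (M.sigmaEndo_le_pi _)
          (stronglyMeasurable_condExp.mono (M.sigmaEndo_mono Set.subset_union_left))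
          integrable_condExp

end SCM

/-! ### Connected components as separations -/

namespace CausalGraph

variable {V E : Type*} {G : CausalGraph V E}

/-- Only the target of each step must lie in `D`, hence the extra condition on the starting point.
-/
theorem Linked.symm {D : Set (V ⊕ E)} {Z : Set V} {a b : V ⊕ E} (ha : a ∈ D)
    (h : G.Linked D Z a b) : G.Linked D Z b a := by
  suffices H : b ∈ D ∧ G.Linked D Z b a from H.2
  induction h with
  | refl => exact ⟨ha, .refl⟩
  | tail _ hbc ih => exact ⟨hbc.2, Relation.ReflTransGen.head ⟨hbc.1.symm, ih.1⟩ ih.2⟩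

theorem separates_linked {S Z : Set V} (hZ : ∀ z ∈ Z, Sum.inl z ∈ G.ancestors S) (x : V ⊕ E) :
    SCM.Separates G {v | Sum.inl v ∈ G.ancestors S} Z {a | G.Linked (G.ancestors S) Z x a} where
  pa_subset v hv u hu := ancestors_of_edge (.endo hu) hv
  subset := hZ
  endo_iff v hv u hu huZ := by
    have h : G.TailAdj Z (Sum.inl u) (Sum.inl v) := Or.inl ⟨.endo hu, by simpa using huZ⟩
    exact ⟨fun h' => Relation.ReflTransGen.tail h' ⟨h, hv⟩,
      fun h' => Relation.ReflTransGen.tail h' ⟨h.symm, ancestors_of_edge (.endo hu) hv⟩⟩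
  exo_iff v hv e he := by
    have h : G.TailAdj Z (Sum.inr e) (Sum.inl v) := Or.inl ⟨.exo he, by simp⟩
    exact ⟨fun h' => Relation.ReflTransGen.tail h' ⟨h, hv⟩,
      fun h' => Relation.ReflTransGen.tail h' ⟨h.symm, ancestors_of_edge (.exo he) hv⟩⟩

end CausalGraph

/-! ### Requisite features separate the others from the utility -/

namespace SLGraph

variable {V E : Type*} (G : SLGraph V E)

theorem Y_mem_pa_U : G.Y ∈ G.pa G.U := by simp [G.pa_U]

theorem Yhat_mem_pa_U : G.Yhat ∈ G.pa G.U := by simp [G.pa_U]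

theorem U_notMem_features : G.U ∉ G.features := fun h =>
  G.acyclic G.U (.tail (.single h) G.Yhat_mem_pa_U)

theorem U_ne_Yhat : G.U ≠ G.Yhat := by
  intro h
  apply G.acyclic G.U
  refine .single ?_
  exact (congrArg (· ∈ G.pa G.U) h).mpr G.Yhat_mem_pa_U

/-- The outcome is requisite if it is a feature. -/
theorem requisite_Y (h : G.Y ∈ G.features) : G.Requisite G.Y := by
  have hU : G.U ∉ (G.features ∪ {G.Yhat}) \ {G.Y} := by
    rintro ⟨h | h, -⟩
    exacts [G.U_notMem_features h, G.U_ne_Yhat h]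
  refine ⟨h, CausalGraph.Linked.dConnected subset_rfl (by simp) hU (.single ⟨Or.inl
    ⟨.endo G.Y_mem_pa_U, by simp⟩, CausalGraph.mem_ancestors (by simp)⟩)⟩

/-- The variables that are linked to the utility given the prediction and all features are
separated from the other ones by the prediction and the requisite features. -/
theorem separates_requisite :
    SCM.Separates G.toCausalGraph {v | Sum.inl v ∈ G.ancestors ({G.U} ∪ G.features)}
      ({W | G.Requisite W} ∪ {G.Yhat})
      {a | G.Linked (G.ancestors ({G.U} ∪ G.features)) (G.features ∪ {G.Yhat}) (Sum.inl G.U) a} ∧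
    ∀ W ∈ G.features, ¬ G.Requisite W →
      ¬ G.Linked (G.ancestors ({G.U} ∪ G.features)) (G.features ∪ {G.Yhat})
        (Sum.inl G.U) (Sum.inl W) := by
  set D := G.ancestors ({G.U} ∪ G.features) with hD
  set F := G.features ∪ {G.Yhat} with hF
  have hUD : Sum.inl G.U ∈ D := CausalGraph.mem_ancestors (by simp)
  have hUF : G.U ∉ F := by
    rintro (h | h)
    exacts [G.U_notMem_features h, G.U_ne_Yhat h]
  have hreq : ∀ W ∈ G.features, ¬ G.Requisite W →
      ¬ G.Linked D (F \ {W}) (Sum.inl G.U) (Sum.inl W) := by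
    intro W hW hreq hlink
    refine hreq ⟨hW, CausalGraph.Linked.dConnected (D := D) ?_ (by simp) (fun h => hUF h.1)
      (hlink.symm hUD)⟩
    refine CausalGraph.ancestors_mono ?_
    rintro v (hv | hv)
    · exact Or.inl (Or.inr hv)
    · by_cases hvW : v = W
      · exact Or.inl (Or.inl hvW)
      · exact Or.inr ⟨Or.inl hv, hvW⟩
  have hnot : ∀ W ∈ G.features, ¬ G.Requisite W →
      ¬ G.Linked D F (Sum.inl G.U) (Sum.inl W) := fun W hW hr h =>
    hreq W hW hr (h.mono subset_rfl Set.sdiff_subset)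
  have hfull : SCM.Separates G.toCausalGraph {v | Sum.inl v ∈ D} F
      {a | G.Linked D F (Sum.inl G.U) a} := by
    refine CausalGraph.separates_linked ?_ _
    rintro z (hz | hz)
    · exact CausalGraph.mem_ancestors (Or.inr hz)
    · obtain rfl : z = G.Yhat := hz
      exact CausalGraph.ancestors_of_edge (.endo G.Yhat_mem_pa_U) hUD
  refine ⟨⟨hfull.pa_subset, ?_, ?_, hfull.exo_iff⟩, hnot⟩
  · exact (Set.union_subset_union_left _ fun W hW => hW.1).trans hfull.subset
  · intro v hv u hu huZ
    by_cases huF : u ∈ G.features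
    -- A non-requisite feature may have outgoing edges here. It is not linked to U; were its child
    -- `v` linked, the edge would link `u` too once `u` is dropped from the conditioning set, making
    -- it requisite.
    · have hur : ¬ G.Requisite u := fun h => huZ (Or.inl h)
      refine iff_of_false (hnot u huF hur) fun h => hreq u huF hur ?_
      exact Relation.ReflTransGen.tail (h.mono subset_rfl Set.sdiff_subset)
        ⟨Or.inr ⟨.endo hu, by simp⟩, CausalGraph.ancestors_of_edge (.endo hu) hv⟩
    · exact hfull.endo_iff v hv u hu fun h => h.elim huF fun h => huZ (Or.inr h)

end SLGraph

/-! ### Predictors, group means and total variation -/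

namespace SLSCM

variable {V E : Type*} [Finite V] {G : SLGraph V E} {dom : V → Type*}
  {edom : E → Type*} [∀ v, MeasurableSpace (dom v)] [∀ e, MeasurableSpace (edom e)]

/-- The structural causal model with predictor `π`. -/
noncomputable abbrev model (M : SLSCM G dom edom)
    (π : {π : ((w : G.features) → dom w) → dom G.Yhat // Measurable π}) :
    SCM G.toCausalGraph dom edom :=
  M.replace G.Yhat π.1 π.2

variable (M : SLSCM G dom edom) (π : M.Predictor)

theorem val_Yhat (ε : ∀ e, edom e) : M.val π G.Yhat ε = π.1 (M.feat π ε) := by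
  rw [val, SCM.solve_eq]
  simp only [SCM.replace, Function.update_self]
  rfl

theorem prediction_eq : M.prediction π = fun ε => M.realYhat (π.1 (M.feat π ε)) :=
  funext fun ε => congrArg M.realYhat (M.val_Yhat π ε)

theorem val_eq_of_not_descendant (π' : M.Predictor) {v : V}
    (hv : ¬ Relation.ReflTransGen (fun u w => u ∈ G.pa w) G.Yhat v) (ε : ∀ e, edom e) :
    M.val π v ε = M.val π' v ε := by
  induction v using G.wellFounded.induction with
  | _ v ih =>
    have hne : v ≠ G.Yhat := by rintro rfl; exact hv .refl
    rw [val, val, SCM.solve_eq, SCM.solve_eq]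
    classical
    simp only [SCM.replace]
    rw [Function.update_of_ne hne, Function.update_of_ne hne]
    exact congrArg (M.f v · _) (funext fun w => ih w w.2 fun h => hv (h.tail w.2))

/-- A feature that descends from Yhat would close a directed cycle, so the predictor cannot
influence it. -/
theorem feat_eq (π' : M.Predictor) : M.feat π = M.feat π' := by
  funext ε w
  refine M.val_eq_of_not_descendant π π' (fun h => ?_) ε
  exact G.acyclic _ (Relation.TransGen.tail' h w.2)

theorem comap_feat :
    MeasurableSpace.comap (M.feat π) inferInstance = (M.model π).sigmaEndo G.features := by
  simp only [MeasurableSpace.pi, MeasurableSpace.comap_iSup, MeasurableSpace.comap_comp,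
    SCM.sigmaEndo]
  rw [iSup_subtype']
  rfl

theorem measurableSet_group {T : Set V} (hT : G.A ∈ T) {a : dom G.A}
    (ha : MeasurableSet ({a} : Set (dom G.A))) :
    MeasurableSet[(M.model π).sigmaEndo T] (M.group π a) :=
  (M.model π).measurable_sigmaEndo hT ha

theorem stronglyMeasurable_outcome {T : Set V} (hT : G.Y ∈ T) :
    StronglyMeasurable[(M.model π).sigmaEndo T] (M.outcome π) :=
  (M.measurableEmbedding_realY.measurable.comp
    ((M.model π).measurable_sigmaEndo hT)).stronglyMeasurable

variable [Fintype E]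

/-- Positive probability is not needed: for a null group both sides are 0 by convention. -/
theorem integral_cond_group {X : (∀ e, edom e) → ℝ} {a : dom G.A} :
    ∫ ε, X ε ∂(M.law[|M.group π a]) =
      (M.law.real (M.group π a))⁻¹ * ∫ ε in M.group π a, X ε ∂M.law := by
  rw [ProbabilityTheory.cond, integral_smul_measure, ENNReal.toReal_inv]
  rfl

/-- If the features screen off `A` from the outcome, then the conditional expectation of the outcome
does not introduce total variation. -/
theorem ITV_eq_zero {T : Set V} (hA : G.A ∈ T) (hint : Integrable (M.outcome π) M.law)
    (hpred : M.prediction π =ᵐ[M.law]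
      M.law[M.outcome π | (M.model π).sigmaEndo G.features])
    (hT : M.law[M.outcome π | (M.model π).sigmaEndo T] =ᵐ[M.law]
      M.law[M.outcome π | (M.model π).sigmaEndo G.features]) : M.ITV π = 0 := by
  have key : ∀ a : dom G.A, MeasurableSet ({a} : Set (dom G.A)) →
      ∫ ε, M.prediction π ε ∂(M.law[|M.group π a]) =
        ∫ ε, M.outcome π ε ∂(M.law[|M.group π a]) := by
    intro a ha
    have hle := (M.model π).sigmaEndo_le_pi T
    have hs := M.measurableSet_group π hA ha
    rw [integral_cond_group, integral_cond_group, ← setIntegral_condExp hle hint hs]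
    congr 1
    exact setIntegral_congr_ae (hle _ hs) ((hpred.trans hT.symm).mono fun x hx _ => hx)
  rw [ITV, ATV, ATV, key _ M.measurableSet_a₀, key _ M.measurableSet_a₁, sub_self]

/-- A prediction that is independent of `A` has no total variation. -/
theorem ATV_eq_zero {m : MeasurableSpace (∀ e, edom e)} (hm : m ≤ MeasurableSpace.pi)
    (hind : Indep m ((M.model π).sigmaEndo {G.A}) M.law) {X h : (∀ e, edom e) → ℝ}
    (hX : X =ᵐ[M.law] h) (hh : StronglyMeasurable[m] h) (hint : Integrable h M.law)
    (h₀ : M.law (M.group π M.a₀) ≠ 0) (h₁ : M.law (M.group π M.a₁) ≠ 0) : M.ATV π X = 0 := by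
  have key : ∀ a : dom G.A, MeasurableSet ({a} : Set (dom G.A)) → M.law (M.group π a) ≠ 0 →
      ∫ ε, X ε ∂(M.law[|M.group π a]) = ∫ ε, h ε ∂M.law := by
    intro a ha hne
    have hle := (M.model π).sigmaEndo_le_pi {G.A}
    have hs := M.measurableSet_group π (T := {G.A}) rfl ha
    have hX' : ∫ ε in M.group π a, X ε ∂M.law = ∫ ε in M.group π a, h ε ∂M.law :=
      setIntegral_congr_ae (hle _ hs) (hX.mono fun x hx _ => hx)
    have hc := condExp_indep_eq hm hle hh hind
    rw [integral_cond_group, hX', ← setIntegral_condExp hle hint hs,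
      setIntegral_congr_ae (hle _ hs) (hc.mono fun x hx _ => hx), setIntegral_const, smul_eq_mul,
      inv_mul_cancel_left₀]
    exact (measureReal_ne_zero_iff).2 hne
  rw [ATV, key _ M.measurableSet_a₀ h₀, key _ M.measurableSet_a₁ h₁, sub_self]

/-- Under a constant predictor the non-requisite features do not help to predict the outcome. -/
theorem condExp_outcome_requisite (hconst : ∃ c, ∀ x, π.1 x = c)
    (hint : Integrable (M.outcome π) M.law) :
    M.law[M.outcome π | (M.model π).sigmaEndo G.features] =ᵐ[M.law]
      M.law[M.outcome π | (M.model π).sigmaEndo {W | G.Requisite W}] := by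
  -- If Y is a feature, it is itself requisite and both sides equal Y. Otherwise Y is outside the
  -- conditioning set, and its edge into U puts it on the side of U.
  by_cases hY : G.Y ∈ G.features
  · rw [condExp_of_stronglyMeasurable ((M.model π).sigmaEndo_le_pi _)
        (M.stronglyMeasurable_outcome π hY) hint,
      condExp_of_stronglyMeasurable ((M.model π).sigmaEndo_le_pi _)
        (M.stronglyMeasurable_outcome π (T := {W | G.Requisite W}) (G.requisite_Y hY)) hint]
  obtain ⟨c, hc⟩ := hconst
  have hsig : ∀ T : Set V,
      (M.model π).sigmaEndo (T ∪ {G.Yhat}) = (M.model π).sigmaEndo T := by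
    refine fun T => le_antisymm ((M.model π).sigmaEndo_le ?_)
      ((M.model π).sigmaEndo_mono Set.subset_union_left)
    rintro v (hv | hv)
    · exact (M.model π).measurable_sigmaEndo hv
    · obtain rfl : v = G.Yhat := hv
      have : (fun ε => (M.model π).solve ε G.Yhat) = fun _ => c :=
        funext fun ε => (M.val_Yhat π ε).trans (hc _)
      rw [this]
      exact measurable_const
  obtain ⟨hsep, hnot⟩ := G.separates_requisite
  have hUD : Sum.inl G.U ∈ G.ancestors ({G.U} ∪ G.features) := CausalGraph.mem_ancestors (by simp)
  have hYD : Sum.inl G.Y ∈ G.ancestors ({G.U} ∪ G.features) :=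
    CausalGraph.ancestors_of_edge (.endo G.Y_mem_pa_U) hUD
  have hYF : G.Y ∉ G.features ∪ {G.Yhat} := fun h => h.elim hY G.Y_ne_Yhat
  have key := hsep.compl.condExp_eq (M.model π) (S := G.features)
    (fun w hw => CausalGraph.mem_ancestors (Or.inr hw)) (fun w hw => ?_) (y := G.Y) hYD ?_
    M.measurableEmbedding_realY.measurable hint
  · have hunion : {W | G.Requisite W} ∪ {G.Yhat} ∪ G.features = G.features ∪ {G.Yhat} := by
      rw [Set.union_right_comm, Set.union_eq_self_of_subset_left
        (s := {W | G.Requisite W}) (t := G.features) fun W hW => hW.1]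
    rw [hunion, hsig, hsig] at key
    exact key
  · by_cases hr : G.Requisite w
    · exact Or.inl (Or.inl hr)
    · exact Or.inr (hnot w hw hr)
  · refine not_not.2 (Relation.ReflTransGen.single ⟨Or.inr ⟨.endo G.Y_mem_pa_U, ?_⟩, hYD⟩)
    simpa using hYF

/-- If `A` is d-separated from the utility given the features, then it carries no information on the
outcome beyond that in the features. -/
theorem condExp_outcome_of_not_dConnected (hA : G.A ∉ G.features)
    (hsep : ¬ G.DConnected G.A G.U G.features) (hint : Integrable (M.outcome π) M.law) :
    M.law[M.outcome π | (M.model π).sigmaEndo (G.features ∪ {G.A})] =ᵐ[M.law]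
      M.law[M.outcome π | (M.model π).sigmaEndo G.features] := by
  by_cases hY : G.Y ∈ G.features
  · rw [condExp_of_stronglyMeasurable ((M.model π).sigmaEndo_le_pi _)
        (M.stronglyMeasurable_outcome π hY) hint,
      condExp_of_stronglyMeasurable ((M.model π).sigmaEndo_le_pi _)
        (M.stronglyMeasurable_outcome π (Or.inl hY)) hint]
  have hUD : Sum.inl G.U ∈ G.ancestors ({G.A, G.U} ∪ G.features) :=
    CausalGraph.mem_ancestors (by simp)
  refine (CausalGraph.separates_linked (G := G.toCausalGraph) (S := {G.A, G.U} ∪ G.features)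
    (fun z hz => CausalGraph.mem_ancestors (Or.inr hz)) (Sum.inl G.A)).condExp_eq (M.model π) (S := {G.A}) ?_ ?_ (y := G.Y)
    (CausalGraph.ancestors_of_edge (.endo G.Y_mem_pa_U) hUD) ?_
    M.measurableEmbedding_realY.measurable hint
  · rintro w rfl
    exact CausalGraph.mem_ancestors (by simp)
  · rintro w rfl
    exact Or.inr .refl
  · intro h
    refine hsep (CausalGraph.Linked.dConnected subset_rfl hA G.U_notMem_features
      (Relation.ReflTransGen.tail h ⟨Or.inl ⟨.endo G.Y_mem_pa_U, ?_⟩, hUD⟩))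
    simpa using hY

/-- Features that are d-separated from `A` are jointly independent of `A`. -/
theorem indep_of_forall_not_dConnected (π' : M.Predictor) {T : Set V}
    (hT : ∀ W ∈ T, ¬ G.DConnected W G.A ∅) :
    Indep ((M.model π').sigmaEndo T) ((M.model π).sigmaEndo {G.A}) M.law := by
  -- A shared exogenous variable would be a common ancestor. Only the graph enters, so the two
  -- σ-algebras may come from models with different predictors.
  have hdisj : Disjoint
      {e | ∃ W ∈ T, Relation.ReflTransGen G.Edge (Sum.inr e) (Sum.inl W)}
      {e | Relation.ReflTransGen G.Edge (Sum.inr e) (Sum.inl G.A)} :=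
    Set.disjoint_left.2 fun e ⟨W, hW, heW⟩ heA =>
      hT W hW (CausalGraph.dConnected_empty_of_common_ancestor heW heA)
  refine indep_of_indep_of_le_left (indep_of_indep_of_le_right (M.indep_sigmaExo hdisj) ?_) ?_
  · refine (M.model π).sigmaEndo_le ?_
    rintro v rfl
    exact (M.model π).measurable_sigmaExo_ancestors _
  · refine (M.model π').sigmaEndo_le fun W hW => ?_
    exact ((M.model π').measurable_sigmaExo_ancestors W).mono
      (biSup_mono fun e he => ⟨W, hW, he⟩) le_rfl

end SLSCM

/-! ### The ITV criterion -/

theorem theorem2 {V E : Type*} [Finite V] [Fintype E] (G : SLGraph V E)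
    {dom : V → Type*} {edom : E → Type*}
    [∀ v, MeasurableSpace (dom v)] [∀ e, MeasurableSpace (edom e)]
    (M : SLSCM G dom edom) (hadm : M.PAdmissible)
    (hITV : ∀ π : M.Predictor, M.Optimal π → M.ITVDefined π ∧ 0 < M.ITV π) :
    (∃ W, G.Requisite W ∧ G.DConnected W G.A ∅) ∧
      G.A ∉ G.features ∧
      G.DConnected G.A G.U G.features := by
  obtain ⟨π, hopt, hcond⟩ := hadm
  obtain ⟨hdef, hpos⟩ := hITV π hopt
  have hint := (hcond π).1
  have hpred : M.prediction π =ᵐ[M.law]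
      M.law[M.outcome π | (M.model π).sigmaEndo G.features] := by
    rw [M.prediction_eq, ← M.comap_feat]
    exact (hcond π).2
  have hA : G.A ∉ G.features := fun hA =>
    hpos.ne' (M.ITV_eq_zero π hA hint hpred Filter.EventuallyEq.rfl)
  refine ⟨?_, hA, ?_⟩
  · by_contra! hno
    obtain ⟨ε₀⟩ : Nonempty (∀ e, edom e) := M.law.nonempty_of_neZero
    -- Any value in the domain of Yhat serves as the constant; one is read off at an arbitrary
    -- sample point.
    let π₀ : M.Predictor := ⟨fun _ => M.val π G.Yhat ε₀, measurable_const⟩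
    -- The features are the same random variables under `π` and `π₀`, so the prediction of `π` is
    -- also the conditional expectation of the outcome under `π₀`.
    have hpred₀ : M.prediction π =ᵐ[M.law]
        M.law[M.outcome π₀ | (M.model π₀).sigmaEndo {W | G.Requisite W}] := by
      refine Filter.EventuallyEq.trans ?_
        (M.condExp_outcome_requisite π₀ ⟨_, fun _ => rfl⟩ (hcond π₀).1)
      rw [M.prediction_eq, ← M.comap_feat, M.feat_eq π π₀]
      exact (hcond π₀).2
    have hATV := M.ATV_eq_zero π ((M.model π₀).sigmaEndo_le_pi _)
      (M.indep_of_forall_not_dConnected π π₀ hno) hpred₀ stronglyMeasurable_condExp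
      integrable_condExp (hdef M.a₀ (by simp)).1.1 (hdef M.a₁ (by simp)).1.1
    rw [SLSCM.ITV, hATV, abs_zero, zero_sub, neg_pos] at hpos
    exact hpos.not_ge (abs_nonneg _)
  · by_contra hsep
    exact hpos.ne' (M.ITV_eq_zero π (Or.inr rfl) hint hpred
      (M.condExp_outcome_of_not_dConnected π hA hsep hint))
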